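/- A *weight* is a nondecreasing map $\omega:[0,\infty)\to(0,\infty)$ such that $\int_0^\infty \frac{dt}{\omega(t)}=\infty$. Let $E$, $F$ and $W$ be real Banach spaces, let $f:E\times F\to W$ be a $C^1$ map, and let $$Z_0:=\{(x,y)\in E\times F: f(x,y)=0\}.$$ Suppose that for every $(x,y)\in Z_0$ the partial derivative $\partial_y f(x,y):F\to W$ is an isomorphism of Banach spaces (a bijective bounded linear map with bounded inverse), and that for some continuous weight $\omega$, $$\|\partial_y f(x,y)^{-1}\|\cdot\|\partial_x f(x,y)\|\le\omega(\|y\|)\qquad\text{for all }(x,y)\in Z_0.$$ If $Z_0$ is nonempty and connected, then there exists a global implicit map for $f$ at $0$, that is, a continuous map $g:E\to F$ such that for all $(x,y)\in E\times F$, $$f(x,y)=0\iff y=g(x);$$ moreover $g$ is the unique map $E\to F$ (continuous or not) with this property. -/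

import Mathlib

open Set MeasureTheory

namespace GlobalImplicit

/-- A weight: a nondecreasing map `ω : [0,∞) → (0,∞)`, not necessarily continuous, such that
`∫₀^∞ dt / ω(t) = ∞`. Only the values of `ω` on `[0,∞)` play a role. -/
structure IsWeight (ω : ℝ → ℝ) : Prop where
  pos : ∀ t, 0 ≤ t → 0 < ω t
  monotoneOn : MonotoneOn ω (Ici 0)
  lintegral_eq_top : ∫⁻ t in Ici (0 : ℝ), ENNReal.ofReal (1 / ω t) = ⊤

/-- The set `Z_w = {(x, y) : f (x, y) = w}`. -/
def levelSet {X Y W : Type*} (f : X × Y → W) (w : W) : Set (X × Y) :=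
  {p | f p = w}

/-- There is a global implicit map for `f` at `w`: a continuous map `g : X → Y` whose graph is
exactly `Z_w`, and `g` is the only map (continuous or not) with that graph. -/
def HasGlobalImplicitMap {X Y W : Type*} [TopologicalSpace X] [TopologicalSpace Y]
    (f : X × Y → W) (w : W) : Prop :=
  ∃ g : X → Y, Continuous g ∧ (∀ x y, f (x, y) = w ↔ y = g x) ∧
    ∀ g' : X → Y, (∀ x y, f (x, y) = w ↔ y = g' x) → g' = g

section Partial

variable {E F W : Type*} [NormedAddCommGroup E] [NormedSpace ℝ E]
  [NormedAddCommGroup F] [NormedSpace ℝ F] [NormedAddCommGroup W] [NormedSpace ℝ W]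

/-- The partial derivative `∂ₓ f (x, y)`, a continuous linear map `E → W`. -/
noncomputable def partialX (f : E × F → W) (x : E) (y : F) : E →L[ℝ] W :=
  fderiv ℝ (fun x' => f (x', y)) x

/-- The partial derivative `∂_y f (x, y)`, a continuous linear map `F → W`. -/
noncomputable def partialY (f : E × F → W) (x : E) (y : F) : F →L[ℝ] W :=
  fderiv ℝ (fun y' => f (x, y')) y

end Partial

end GlobalImplicit

/-! By the implicit function theorem the zero set `Z` is locally a graph over `E`, with slope at
most `ω ‖y‖`, so its projection to `E` is a local homeomorphism. Along a lift of a segment, `‖y‖`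
stays below a solution of `B' = c * ω B`, which cannot blow up in finite time because `∫ 1/ω`
diverges. Hence `y` is bounded, so Lipschitz, and converges since `F` is complete; the limit stays
in the closed set `Z` (`IsLocalGraph.exists_tendsto_lift`). So every segment issuing from one base
point lifts to its end (`exists_lift_Icc_of_exists_tendsto`). The endpoints of the lifts form a
continuous section `g`, whose graph is open and closed in `Z`, hence all of `Z` by connectedness. -/

namespace GlobalImplicit

open Filter Topology

/-! ### Path lifting -/

/-- A partially defined lift of a path through a separated local homeomorphism extends to `[0, 1]`
as soon as every lift on `[0, T)` converges at `T`. -/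
theorem exists_lift_Icc_of_exists_tendsto {Z X : Type*} [TopologicalSpace Z] [TopologicalSpace X]
    [T2Space X] {p : Z → X} (hp : IsLocalHomeomorph p) (hsep : IsSeparatedMap p)
    {γ : ℝ → X} (hγ : Continuous γ) {z₀ : Z} (hz₀ : p z₀ = γ 0)
    (hlim : ∀ T ∈ Ioc (0 : ℝ) 1, ∀ z : ℝ → Z, ContinuousOn z (Ico 0 T) → z 0 = z₀ →
      (∀ t ∈ Ico 0 T, p (z t) = γ t) → ∃ e, Tendsto z (𝓝[<] T) (𝓝 e)) :
    ∃ z : ℝ → Z, ContinuousOn z (Icc 0 1) ∧ z 0 = z₀ ∧ ∀ t ∈ Icc (0 : ℝ) 1, p (z t) = γ t := by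
  let IsLift (T : ℝ) (z : ℝ → Z) : Prop :=
    ContinuousOn z (Icc 0 T) ∧ z 0 = z₀ ∧ ∀ t ∈ Icc (0 : ℝ) T, p (z t) = γ t
  let S : Set ℝ := {T | T ∈ Icc (0 : ℝ) 1 ∧ ∃ z, IsLift T z}
  have mono {T T' : ℝ} {z : ℝ → Z} (h : T' ≤ T) (hz : IsLift T z) : IsLift T' z :=
    ⟨hz.1.mono (Icc_subset_Icc_right h), hz.2.1, fun t ht => hz.2.2 t ⟨ht.1, ht.2.trans h⟩⟩
  have uniq {T : ℝ} {z z' : ℝ → Z} (hT : 0 ≤ T) (h : IsLift T z) (h' : IsLift T z') :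
      EqOn z z' (Icc 0 T) :=
    hsep.eqOn_of_comp_eqOn hp.isLocallyInjective isPreconnected_Icc h.1 h'.1
      (fun t ht => (h.2.2 t ht).trans (h'.2.2 t ht).symm) (left_mem_Icc.2 hT)
      (h.2.1.trans h'.2.1.symm)
  have hS0 : (0 : ℝ) ∈ S := by
    refine ⟨⟨le_rfl, zero_le_one⟩, fun _ => z₀, continuousOn_const, rfl, fun t ht => ?_⟩
    rw [le_antisymm ht.2 ht.1, hz₀]
  have hbdd : BddAbove S := ⟨1, fun t ht => ht.1.2⟩
  set T := sSup S
  have hT0 : 0 ≤ T := le_csSup hbdd hS0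
  have hT1 : T ≤ 1 := csSup_le ⟨0, hS0⟩ fun t ht => ht.1.2
  have hlt : ∀ t, ∃ z, t < T → IsLift t z := by
    intro t
    by_cases ht : t < T
    · obtain ⟨s, hs, hts⟩ := exists_lt_of_lt_csSup ⟨0, hS0⟩ ht
      obtain ⟨z, hz⟩ := hs.2
      exact ⟨z, fun _ => mono hts.le hz⟩
    · exact ⟨fun _ => z₀, fun h => absurd h ht⟩
  have hTS : ∃ z, IsLift T z := by
    rcases hT0.eq_or_lt with h0 | hTpos
    · rw [← h0]; exact hS0.2
    choose ζ hζ using hlt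
    have agree {t s : ℝ} (ht : 0 ≤ t) (hts : t ≤ s) (hs : s < T) : ζ t t = ζ s t :=
      uniq ht (hζ t (hts.trans_lt hs)) (mono hts (hζ s hs)) ⟨ht, le_rfl⟩
    -- Near `t` the diagonal coincides with the single lift `ζ s`, for any `s` strictly between `t`
    -- and `T`.
    have hcont : ContinuousOn (fun t => ζ t t) (Ico 0 T) := by
      intro t ht
      obtain ⟨s, hts, hsT⟩ := exists_between ht.2
      have hmem : Icc 0 s ∈ 𝓝[Ico 0 T] t := by
        filter_upwards [self_mem_nhdsWithin, mem_nhdsWithin_of_mem_nhds (Iio_mem_nhds hts)]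
          with r hr hr' using ⟨hr.1, le_of_lt hr'⟩
      have h1 : ContinuousWithinAt (ζ s) (Ico 0 T) t :=
        ((hζ s hsT).1 t ⟨ht.1, hts.le⟩).mono_of_mem_nhdsWithin hmem
      refine h1.congr_of_eventuallyEq ?_ (agree ht.1 hts.le hsT)
      filter_upwards [hmem] with r hr using agree hr.1 hr.2 hsT
    have hzero : ζ 0 0 = z₀ := (hζ 0 hTpos).2.1
    have hlift : ∀ t ∈ Ico 0 T, p (ζ t t) = γ t := fun t ht => (hζ t ht.2).2.2 t ⟨ht.1, le_rfl⟩
    obtain ⟨e, he⟩ := hlim T ⟨hTpos, hT1⟩ _ hcont hzero hlift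
    have hpe : p e = γ T := by
      refine tendsto_nhds_unique ((hp.continuous.tendsto e).comp he)
        (((hγ.tendsto T).mono_left nhdsWithin_le_nhds).congr' ?_)
      filter_upwards [Ico_mem_nhdsLT hTpos] with t ht using (hlift t ht).symm
    refine ⟨Function.update (fun t => ζ t t) T e, ?_, ?_, ?_⟩
    · rw [continuousOn_update_iff, Icc_sdiff_right]
      exact ⟨hcont, fun _ => he.mono_left (nhdsWithin_mono _ fun t ht => ht.2)⟩
    · rw [Function.update_of_ne hTpos.ne, hzero]
    · intro t ht
      rcases eq_or_ne t T with rfl | h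
      · rw [Function.update_self, hpe]
      · rw [Function.update_of_ne h]; exact hlift t ⟨ht.1, lt_of_le_of_ne ht.2 h⟩
  obtain ⟨z, hz⟩ := hTS
  rcases hT1.eq_or_lt with h1 | hlt1
  · rw [h1] at hz; exact ⟨z, hz⟩
  exfalso
  -- If `T < 1`, the inverse of a chart at `z T` continues the lift beyond the supremum.
  obtain ⟨q, hq, rfl⟩ := hp (z T)
  have hqT : q (z T) = γ T := hz.2.2 T ⟨hT0, le_rfl⟩
  have hmem : γ ⁻¹' q.target ∈ 𝓝 T :=
    hγ.continuousAt.preimage_mem_nhds (q.open_target.mem_nhds (hqT ▸ q.map_source hq))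
  obtain ⟨ε, hε, hball⟩ := Metric.mem_nhds_iff.1 hmem
  let T' := min 1 (T + ε / 2)
  have hTT' : T < T' := lt_min hlt1 (by linarith)
  have htarget : ∀ t ∈ Icc T T', γ t ∈ q.target := by
    intro t ht
    apply hball
    rw [Metric.mem_ball, Real.dist_eq, abs_of_nonneg (by linarith [ht.1])]
    linarith [ht.2.trans (min_le_right 1 (T + ε / 2))]
  have hsymm : q.symm (γ T) = z T := by rw [← hqT, q.left_inv hq]
  refine hTT'.not_ge (le_csSup hbdd ⟨⟨hT0.trans hTT'.le, min_le_left _ _⟩,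
    fun t => if t ≤ T then z t else q.symm (γ t), ?_, ?_, ?_⟩)
  · refine ContinuousOn.if (fun t ht => ?_) (hz.1.mono fun t ht => ?_) ?_
    · have : t = T := frontier_le_subset_eq continuous_id continuous_const ht.2
      rw [this, hsymm]
    · have h := ht.2
      rw [closure_le_eq continuous_id' continuous_const] at h
      exact ⟨ht.1.1, h⟩
    · simp_rw [not_le]
      exact q.continuousOn_symm.comp hγ.continuousOn fun t ht =>
        htarget t ⟨closure_lt_subset_le continuous_const continuous_id ht.2, ht.1.2⟩
  · simp only [if_pos hT0]; exact hz.2.1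
  · intro t ht
    by_cases h : t ≤ T
    · simp only [if_pos h]; exact hz.2.2 t ⟨ht.1, h⟩
    · simp only [if_neg h]; exact q.right_inv (htarget t ⟨(not_le.1 h).le, ht.2⟩)

/-! ### The comparison equation -/

/-- For a continuous weight `ω` the equation `B' = c ω(B)` has a nondecreasing solution on
`[0, ∞)` with any prescribed nonnegative initial value. -/
theorem IsWeight.exists_majorant {ω : ℝ → ℝ} (hω : IsWeight ω) (hωc : ContinuousOn ω (Ici 0))
    {r c : ℝ} (hr : 0 ≤ r) (hc : 0 ≤ c) :
    ∃ B : ℝ → ℝ, B 0 = r ∧ Monotone B ∧ ∀ t, 0 ≤ t → HasDerivAt B (c * ω (B t)) t := by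
  -- Freezing `ω` at `ω 0` on the negative axis makes the primitive `Φ` of `1/ω` a bijection of `ℝ`;
  -- separation of variables then gives `B t = Φ⁻¹ (Φ r + c * t)`.
  let u : ℝ → ℝ := fun t => 1 / ω (max t 0)
  have hu_pos : ∀ t, 0 < u t := fun t => one_div_pos.2 (hω.pos _ (le_max_right _ _))
  have hω' : Continuous fun t => ω (max t 0) :=
    hωc.comp_continuous (by fun_prop) fun t => le_max_right t 0
  have hu : Continuous u :=
    continuous_const.div hω' fun t => (hω.pos _ (le_max_right _ _)).ne'
  let Φ : ℝ → ℝ := fun s => ∫ t in (0 : ℝ)..s, u t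
  have hΦ' : ∀ s, HasDerivAt Φ (u s) s := fun s => hu.integral_hasStrictDerivAt 0 s |>.hasDerivAt
  have hΦc : Continuous Φ := continuous_iff_continuousAt.2 fun s => (hΦ' s).continuousAt
  have hΦm : StrictMono Φ := strictMono_of_deriv_pos fun s => by rw [(hΦ' s).deriv]; exact hu_pos s
  have htop : Tendsto Φ atTop atTop := by
    refine tendsto_atTop_atTop_of_monotone' hΦm.monotone ?_
    rintro ⟨M, hM⟩
    have hint : IntegrableOn u (Ioi 0) := by
      refine integrableOn_Ioi_of_intervalIntegral_norm_bounded M 0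
        (fun i : ℝ => (hu.integrableOn_Icc (a := 0) (b := i)).mono_set Ioc_subset_Icc_self)
        tendsto_id (Eventually.of_forall fun i => ?_)
      simp_rw [Real.norm_of_nonneg (hu_pos _).le]
      exact hM ⟨i, rfl⟩
    have h1 := hint.lintegral_lt_top
    refine h1.ne ?_
    rw [← hω.lintegral_eq_top, ← setLIntegral_congr Ioi_ae_eq_Ici]
    refine setLIntegral_congr_fun measurableSet_Ioi fun t ht => ?_
    simp only [u, max_eq_left (le_of_lt (mem_Ioi.1 ht))]
  have hbot : Tendsto Φ atBot atBot := by
    have h : ∀ᶠ s in atBot, s * u 0 = Φ s := by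
      filter_upwards [eventually_le_atBot (0 : ℝ)] with s hs
      have : Φ s = ∫ _ in (0 : ℝ)..s, u 0 := by
        refine intervalIntegral.integral_congr fun t ht => ?_
        rw [uIcc_of_ge hs] at ht
        simp only [u, max_eq_right ht.2, max_self]
      rw [this]; simp
    exact (tendsto_id.atBot_mul_const (hu_pos 0)).congr' h
  let e : ℝ ≃o ℝ := hΦm.orderIsoOfSurjective Φ (hΦc.surjective htop hbot)
  have he : ∀ s, Φ (e.symm s) = s := fun s => e.apply_symm_apply s
  have he' : ∀ s, e.symm (Φ s) = s := fun s => e.symm_apply_apply s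
  refine ⟨fun t => e.symm (Φ r + c * t), by simp [he'],
    fun s t hst => e.symm.monotone (by gcongr), fun t ht => ?_⟩
  have hnonneg : 0 ≤ e.symm (Φ r + c * t) :=
    hr.trans ((he' r).symm.trans_le (e.symm.monotone (by nlinarith)))
  have hd : HasDerivAt e.symm (u (e.symm (Φ r + c * t)))⁻¹ (Φ r + c * t) :=
    HasDerivAt.of_local_left_inverse e.symm.continuous.continuousAt (hΦ' _) (hu_pos _).ne'
      (Eventually.of_forall he)
  have hlin : HasDerivAt (fun t => Φ r + c * t) c t := by
    simpa using ((hasDerivAt_id t).const_mul c).const_add (Φ r)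
  refine (hd.comp t hlin).congr_deriv ?_
  simp only [u, one_div, inv_inv, max_eq_left hnonneg, mul_comm]

/-! ### Local graphs and their projection -/

variable {E F W : Type*} [NormedAddCommGroup E] [NormedSpace ℝ E]
  [NormedAddCommGroup F] [NormedSpace ℝ F] [NormedAddCommGroup W] [NormedSpace ℝ W]

/-- A set `Z ⊆ E × F` that near each of its points is the graph of a map `φ`
differentiable at that point, with `‖φ'‖ ≤ ω ‖y‖`. -/
def IsLocalGraph (Z : Set (E × F)) (ω : ℝ → ℝ) : Prop :=
  ∀ p ∈ Z, ∃ (φ : E → F) (φ' : E →L[ℝ] F), HasFDerivAt φ φ' p.1 ∧ ‖φ'‖ ≤ ω ‖p.2‖ ∧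
    ∀ᶠ q in 𝓝 p, q ∈ Z ↔ φ q.1 = q.2

/-- The implicit function theorem: the zero set is locally a graph. -/
theorem isLocalGraph_levelSet [CompleteSpace E] [CompleteSpace F] [CompleteSpace W]
    {f : E × F → W} (hf : ContDiff ℝ 1 f)
    (hiso : ∀ x y, (x, y) ∈ levelSet f 0 → (partialY f x y).IsInvertible) {ω : ℝ → ℝ}
    (hbound : ∀ x y, (x, y) ∈ levelSet f 0 →
      ‖(partialY f x y).inverse‖ * ‖partialX f x y‖ ≤ ω ‖y‖) :
    IsLocalGraph (levelSet f 0) ω := by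
  rintro ⟨x, y⟩ hp
  have hd : HasFDerivAt f (fderiv ℝ f (x, y)) (x, y) :=
    (hf.differentiable one_ne_zero).differentiableAt.hasFDerivAt
  have hY : fderiv ℝ f (x, y) ∘L .inr ℝ E F = partialY f x y :=
    (hd.comp y (hasFDerivAt_prodMk_right x y)).fderiv.symm
  have hX : fderiv ℝ f (x, y) ∘L .inl ℝ E F = partialX f x y :=
    (hd.comp x (hasFDerivAt_prodMk_left x y)).fderiv.symm
  have cdf : ContDiffAt ℝ 1 f (x, y) := hf.contDiffAt
  have hinv : (fderiv ℝ f (x, y) ∘L .inr ℝ E F).IsInvertible := hY ▸ hiso x y hp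
  refine ⟨cdf.implicitFunction one_ne_zero hinv, _,
    (cdf.hasStrictFDerivAt_implicitFunction one_ne_zero hinv).hasFDerivAt, ?_, ?_⟩
  · rw [hX, hY, norm_neg]
    exact (ContinuousLinearMap.opNorm_comp_le _ _).trans (hbound x y hp)
  · have hp' : f (x, y) = 0 := hp
    simpa only [hp', levelSet, mem_ofPred_eq] using cdf.eventually_apply_eq_iff_implicitFunction one_ne_zero hinv

omit [NormedSpace ℝ E] [NormedSpace ℝ F] in
theorem isSeparatedMap_fst (Z : Set (E × F)) : IsSeparatedMap fun z : Z => z.1.1 :=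
  T2Space.isSeparatedMap _

/-- Continuity of `φ` at the single point `p.1` suffices: `x ↦ (x, φ x)` sends points near `p.1`
into any neighbourhood of `p` in `Z`, so the projection is open. It is injective near `p` because
`φ` determines the second coordinate. -/
theorem IsLocalGraph.isLocalHomeomorph {Z : Set (E × F)} {ω : ℝ → ℝ} (hZ : IsLocalGraph Z ω) :
    IsLocalHomeomorph fun z : Z => z.1.1 := by
  have hcont : Continuous fun z : Z => z.1.1 := continuous_fst.comp continuous_subtype_val
  have hopen : IsOpenMap fun z : Z => z.1.1 := by
    refine isOpenMap_iff_nhds_le.2 fun ⟨p, hp⟩ => ?_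
    obtain ⟨φ, φ', hφ, -, hgr⟩ := hZ p hp
    have hpp : φ p.1 = p.2 := hgr.self_of_nhds.1 hp
    have htend : Tendsto (fun x => (x, φ x)) (𝓝 p.1) (𝓝 p) := by
      have := continuousAt_id.prodMk hφ.continuousAt
      simpa only [ContinuousAt, id, hpp] using this
    intro s hs
    rw [mem_map, nhds_subtype_eq_comap, mem_comap] at hs
    obtain ⟨t, ht, hts⟩ := hs
    filter_upwards [htend.eventually hgr, htend ht] with x hx hxt
    exact hts (show (⟨(x, φ x), hx.2 rfl⟩ : Z) ∈ Subtype.val ⁻¹' t from hxt)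
  rw [isLocalHomeomorph_iff_isOpenEmbedding_restrict]
  rintro ⟨p, hp⟩
  obtain ⟨φ, φ', hφ, -, hgr⟩ := hZ p hp
  obtain ⟨U, hU, hUo, hpU⟩ := mem_nhds_iff.1 hgr
  have hVo : IsOpen (Subtype.val ⁻¹' U : Set Z) := hUo.preimage continuous_subtype_val
  refine ⟨_, hVo.mem_nhds hpU, .of_continuous_injective_isOpenMap
    (hcont.comp continuous_subtype_val) ?_ (hopen.domRestrict hVo)⟩
  rintro ⟨⟨a, ha⟩, haU⟩ ⟨⟨b, hb⟩, hbU⟩ hab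
  have hab' : a.1 = b.1 := hab
  have h2 : a.2 = b.2 := by rw [← (hU haU).1 ha, ← (hU hbU).1 hb, hab']
  simp only [Subtype.mk.injEq]
  exact Prod.ext hab' h2

/-! ### A priori bounds on lifts -/

/-- A continuous lift of a segment has a right derivative controlled by `ω`. -/
theorem IsLocalGraph.exists_hasDerivWithinAt {Z : Set (E × F)} {ω : ℝ → ℝ}
    (hZ : IsLocalGraph Z ω) {x v : E} {T : ℝ} {z : ℝ → Z} (hz : ContinuousOn z (Ico 0 T))
    (hlift : ∀ t ∈ Ico 0 T, (z t).1.1 = x + t • v) {t : ℝ} (ht : t ∈ Ico 0 T) :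
    ∃ w, HasDerivWithinAt (fun s => (z s).1.2) w (Ici t) t ∧ ‖w‖ ≤ ω ‖(z t).1.2‖ * ‖v‖ := by
  obtain ⟨φ, φ', hφ, hle, hgr⟩ := hZ (z t).1 (z t).2
  refine ⟨φ' v, ?_, (φ'.le_opNorm v).trans (by gcongr)⟩
  have hmem : Ico 0 T ∈ 𝓝[≥] t :=
    mem_of_superset (Ico_mem_nhdsGE ht.2) (Ico_subset_Ico_left ht.1)
  have hzt : ContinuousWithinAt z (Ici t) t := (hz t ht).mono_of_mem_nhdsWithin hmem
  have hseg : HasDerivAt (fun s : ℝ => x + s • v) v t := by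
    simpa using ((hasDerivAt_id t).smul_const v).const_add x
  rw [hlift t ht] at hφ
  refine (hφ.comp_hasDerivAt t hseg).hasDerivWithinAt.congr_of_eventuallyEq_of_mem ?_ self_mem_Ici
  filter_upwards [hmem, (continuous_subtype_val.continuousAt.comp_continuousWithinAt hzt) hgr]
    with s hs hs'
  rw [Function.comp_apply, ← hlift s hs]
  exact (hs'.1 (z s).2).symm

/-- If `Z` is closed and locally a graph with slopes controlled by a continuous weight, then every
continuous lift of a half-open segment converges at the open end. -/
theorem IsLocalGraph.exists_tendsto_lift [CompleteSpace F] {Z : Set (E × F)} {ω : ℝ → ℝ}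
    (hZ : IsLocalGraph Z ω) (hZc : IsClosed Z) (hω : IsWeight ω) (hωc : ContinuousOn ω (Ici 0))
    {x v : E} {T : ℝ} (hT : 0 < T) {z : ℝ → Z} (hz : ContinuousOn z (Ico 0 T))
    (hlift : ∀ t ∈ Ico 0 T, (z t).1.1 = x + t • v) : ∃ e, Tendsto z (𝓝[<] T) (𝓝 e) := by
  let y : ℝ → F := fun t => (z t).1.2
  have hy : ContinuousOn y (Ico 0 T) :=
    (continuous_snd.comp continuous_subtype_val).comp_continuousOn hz
  have hder : ∀ t, ∃ w, t ∈ Ico 0 T →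
      HasDerivWithinAt y w (Ici t) t ∧ ‖w‖ ≤ ω ‖y t‖ * ‖v‖ := by
    intro t
    by_cases ht : t ∈ Ico 0 T
    · obtain ⟨w, hw⟩ := hZ.exists_hasDerivWithinAt hz hlift ht
      exact ⟨w, fun _ => hw⟩
    · exact ⟨0, fun h => absurd h ht⟩
  choose y' hy' using hder
  -- The constant is `‖v‖ + 1` rather than `‖v‖` because the comparison theorem asks for a strict
  -- inequality of derivatives wherever `‖y s‖ = B s`.
  obtain ⟨B, hB0, hBm, hB⟩ := hω.exists_majorant hωc (norm_nonneg (y 0))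
    (add_nonneg (norm_nonneg v) zero_le_one)
  have hsub {s t : ℝ} (hs : 0 ≤ s) (ht : t < T) : Icc s t ⊆ Ico 0 T := fun r hr =>
    ⟨hs.trans hr.1, hr.2.trans_lt ht⟩
  have hyB : ∀ t ∈ Ico 0 T, ‖y t‖ ≤ B T := by
    intro t ht
    refine le_trans ?_ (hBm ht.2.le)
    refine image_norm_le_of_norm_deriv_right_lt_deriv_boundary' (hy.mono (hsub le_rfl ht.2))
      (fun s hs => (hy' s (hsub le_rfl ht.2 (Ico_subset_Icc_self hs))).1) hB0.ge
      (fun s hs => (hB s hs.1).continuousAt.continuousWithinAt)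
      (fun s hs => (hB s hs.1).hasDerivWithinAt) (fun s hs hsB => ?_) ⟨ht.1, le_rfl⟩
    refine (hy' s (hsub le_rfl ht.2 (Ico_subset_Icc_self hs))).2.trans_lt ?_
    rw [← hsB, mul_comm]
    have := hω.pos ‖y s‖ (norm_nonneg _)
    nlinarith
  have hBT : 0 ≤ B T := (norm_nonneg _).trans (hyB 0 ⟨le_rfl, hT⟩)
  have hC : 0 ≤ ω (B T) * ‖v‖ := mul_nonneg (hω.pos _ hBT).le (norm_nonneg v)
  have hbd : ∀ t ∈ Ico 0 T, ‖y' t‖ ≤ ω (B T) * ‖v‖ := fun t ht =>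
    (hy' t ht).2.trans (mul_le_mul_of_nonneg_right
      (hω.monotoneOn (norm_nonneg _) hBT (hyB t ht)) (norm_nonneg v))
  have hle : ∀ s ∈ Ico 0 T, ∀ t ∈ Ico 0 T, s ≤ t →
      dist (y t) (y s) ≤ ω (B T) * ‖v‖ * dist t s := by
    intro s hs t ht hst
    rw [dist_eq_norm, Real.dist_eq, abs_of_nonneg (sub_nonneg.2 hst)]
    exact norm_image_sub_le_of_norm_deriv_right_le_segment (hy.mono (hsub hs.1 ht.2))
      (fun r hr => (hy' r (hsub hs.1 ht.2 (Ico_subset_Icc_self hr))).1)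
      (fun r hr => hbd r (hsub hs.1 ht.2 (Ico_subset_Icc_self hr))) t ⟨hst, le_rfl⟩
  have hlip : LipschitzOnWith ⟨ω (B T) * ‖v‖, hC⟩ y (Ico 0 T) := by
    refine LipschitzOnWith.of_dist_le_mul fun s hs t ht => ?_
    rcases le_total s t with h | h
    · rw [dist_comm (y s), dist_comm s]; exact hle s hs t ht h
    · exact hle t ht s hs h
  have hnhds : Ico 0 T ∈ 𝓝[<] T := Ico_mem_nhdsLT hT
  obtain ⟨b, hb⟩ := cauchy_map_iff_exists_tendsto.1 <|
    (cauchy_nhds.mono nhdsWithin_le_nhds : Cauchy (𝓝[<] T)).map_of_le hlip.uniformContinuousOn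
      (le_principal_iff.2 hnhds)
  have ha : Tendsto (fun t => (z t).1.1) (𝓝[<] T) (𝓝 (x + T • v)) := by
    have hc : Continuous fun t : ℝ => x + t • v := by fun_prop
    refine ((hc.tendsto T).mono_left nhdsWithin_le_nhds).congr' ?_
    filter_upwards [hnhds] with t ht using (hlift t ht).symm
  have hab : Tendsto (fun t => (z t).1) (𝓝[<] T) (𝓝 (x + T • v, b)) := ha.prodMk_nhds hb
  exact ⟨⟨_, hZc.mem_of_tendsto hab (Eventually.of_forall fun t => (z t).2)⟩,
    tendsto_subtype_rng.2 hab⟩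

/-! ### From lifts to a global graph -/

open unitInterval in
/-- A closed connected set that is locally a graph with slopes controlled by a continuous weight
is the graph of a continuous map. -/
theorem IsLocalGraph.exists_continuous_eq_graph [CompleteSpace F] {Z : Set (E × F)} {ω : ℝ → ℝ}
    (hZ : IsLocalGraph Z ω) (hZc : IsClosed Z) (hω : IsWeight ω) (hωc : ContinuousOn ω (Ici 0))
    (hconn : IsConnected Z) :
    ∃ g : E → F, Continuous g ∧ ∀ x y, (x, y) ∈ Z ↔ y = g x := by
  obtain ⟨⟨p₀, hp₀⟩⟩ := hconn.nonempty.to_subtype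
  have hlift (x : E) : ∃ z : ℝ → Z, ContinuousOn z (Icc 0 1) ∧ z 0 = ⟨p₀, hp₀⟩ ∧
      ∀ t ∈ Icc (0 : ℝ) 1, (z t).1.1 = p₀.1 + t • (x - p₀.1) :=
    exists_lift_Icc_of_exists_tendsto (γ := fun t => p₀.1 + t • (x - p₀.1)) hZ.isLocalHomeomorph
      (isSeparatedMap_fst Z) (by fun_prop) (by simp)
      fun T hT z hz _ hl => hZ.exists_tendsto_lift hZc hω hωc hT.1 hz hl
  choose ζ hζc hζ0 hζ using hlift
  let H : C(I × E, E) := ⟨fun q => p₀.1 + (q.1 : ℝ) • (q.2 - p₀.1), by fun_prop⟩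
  -- The lifts are continuous in time and all start at the same point, so uniqueness of lifts makes
  -- them jointly continuous in time and endpoint.
  have hG : Continuous fun q : I × E => ζ q.2 q.1 := by
    refine hZ.isLocalHomeomorph.continuous_lift (isSeparatedMap_fst Z) H
      (funext fun q => hζ q.2 q.1 q.1.2) ?_
      fun x => (hζc x).comp_continuous continuous_subtype_val fun t => t.2
    simp only [Icc.coe_zero, hζ0]
    exact continuous_const
  let g : E → F := fun x => (ζ x 1).1.2
  have hg : Continuous g := continuous_snd.comp <| continuous_subtype_val.comp <|
    hG.comp (Continuous.prodMk_right (1 : I))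
  have hgZ (x : E) : (x, g x) ∈ Z := by
    have h1 : (ζ x 1).1.1 = x := by simpa using hζ x 1 ⟨zero_le_one, le_rfl⟩
    have := (ζ x 1).2
    rwa [← Prod.mk.eta (p := (ζ x 1).1), h1] at this
  -- The segment from `p₀.1` to itself is constant, so its lift is constant too.
  have hg0 : g p₀.1 = p₀.2 := by
    have h := (isSeparatedMap_fst Z).eqOn_of_comp_eqOn hZ.isLocalHomeomorph.isLocallyInjective
      isPreconnected_Icc (hζc p₀.1) (continuousOn_const (c := (⟨p₀, hp₀⟩ : Z)))
      (fun t ht => by simp [hζ p₀.1 t ht]) (left_mem_Icc.2 zero_le_one) (hζ0 p₀.1)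
      (right_mem_Icc.2 zero_le_one)
    exact congrArg (fun z : Z => z.1.2) h
  refine ⟨g, hg, fun x y => ⟨fun hxy => ?_, fun h => h ▸ hgZ x⟩⟩
  have : PreconnectedSpace Z := Subtype.preconnectedSpace hconn.isPreconnected
  let A : Set Z := {z | z.1.2 = g z.1.1}
  have hAc : IsClosed A := isClosed_eq (by fun_prop) (by fun_prop)
  -- Near a point of `A`, both `z` and `(z.1.1, g z.1.1)` lie in `Z` and in the region where `Z` is
  -- the graph of one `φ`, so they coincide.
  have hAo : IsOpen A := by
    rw [isOpen_iff_mem_nhds]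
    rintro ⟨p, hp⟩ hpA
    obtain ⟨φ, -, -, -, hgr⟩ := hZ p hp
    have hpA' : p.2 = g p.1 := hpA
    have htend : Tendsto (fun q : E × F => (q.1, g q.1)) (𝓝 p) (𝓝 p) := by
      have hc : Continuous fun q : E × F => (q.1, g q.1) := by fun_prop
      simpa only [← hpA'] using hc.tendsto p
    have hev := continuous_subtype_val.continuousAt (x := (⟨p, hp⟩ : Z))
      (hgr.and (htend.eventually hgr))
    filter_upwards [hev] with z hz
    exact (hz.1.1 z.2).symm.trans (hz.2.1 (hgZ z.1.1))
  have hA : A = univ := IsClopen.eq_univ ⟨hAc, hAo⟩ ⟨⟨p₀, hp₀⟩, hg0.symm⟩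
  have hmem : (⟨(x, y), hxy⟩ : Z) ∈ A := hA ▸ mem_univ _
  exact hmem

end GlobalImplicit

theorem mainTheorem12
    {E F W : Type*}
    [NormedAddCommGroup E] [NormedSpace ℝ E] [CompleteSpace E]
    [NormedAddCommGroup F] [NormedSpace ℝ F] [CompleteSpace F]
    [NormedAddCommGroup W] [NormedSpace ℝ W] [CompleteSpace W]
    (f : E × F → W) (hf : ContDiff ℝ 1 f)
    (hiso : ∀ x y, (x, y) ∈ GlobalImplicit.levelSet f 0 →
      (GlobalImplicit.partialY f x y).IsInvertible)
    (ω : ℝ → ℝ) (hω : GlobalImplicit.IsWeight ω) (hωc : ContinuousOn ω (Set.Ici 0))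
    (hbound : ∀ x y, (x, y) ∈ GlobalImplicit.levelSet f 0 →
      ‖(GlobalImplicit.partialY f x y).inverse‖ * ‖GlobalImplicit.partialX f x y‖ ≤ ω ‖y‖)
    (hconn : IsConnected (GlobalImplicit.levelSet f 0)) :
    GlobalImplicit.HasGlobalImplicitMap f 0 := by
  obtain ⟨g, hg, hgf⟩ := (GlobalImplicit.isLocalGraph_levelSet hf hiso hbound
    ).exists_continuous_eq_graph (isClosed_singleton.preimage hf.continuous) hω hωc hconn
  exact ⟨g, hg, hgf, fun g' hg' => funext fun x => (hgf x (g' x)).1 ((hg' x (g' x)).2 rfl)⟩
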